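/- Let $H$ be a nonzero finite-dimensional complex Hilbert space and let $\Phi:B(H)\to B(H)$ be a quantum channel (a completely positive trace-preserving linear map). Let \[ \mathcal X_\Phi=\operatorname{span}\{X\in B(H):\exists\lambda\in\mathbb C,\ |\lambda|=1,\ \Phi(X)=\lambda X\} \] be its peripheral subspace, and let $\mathcal P$ be its peripheral projection, that is, the linear map on $B(H)$ with range $\mathcal X_\Phi$ which fixes every element of $\mathcal X_\Phi$ and is a limit $\mathcal P=\lim_{i\to\infty}\Phi^{n_i}$ for some non-decreasing sequence of non-negative integers $n_i$. Suppose that, for some orthogonal decomposition $H=H_0\oplus\bigoplus_{k=1}^K(H_{k,1}\otimes H_{k,2})$ with $\dim H_{k,1}=d_k$ (where $H_0=0$ is allowed), and for some full-rank states $\omega_k$ on $H_{k,2}$, \[ \mathcal X_\Phi=0\oplus\bigoplus_{k=1}^K B(H_{k,1})\otimes\omega_k . \] Then \[ \chi(\mathcal P)=\log\Big(\sum_{k=1}^K d_k\Big),\qquad I_c(\mathcal P)=\log\Big(\max_{1\le k\le K} d_k\Big). \] Here $H(\rho)=-\operatorname{tr}(\rho\log\rho)$ is the von Neumann entropy, with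 $\log$ the natural logarithm. For a bipartite state $\omega_{AB}$ with marginals $\omega_A,\omega_B$, put $I(A:B)_\omega=H(\omega_A)+H(\omega_B)-H(\omega_{AB})$ and $I(A\rangle B)_\omega=H(\omega_B)-H(\omega_{AB})$. The Holevo quantity is \[ \chi(\mathcal P)=\sup_{\rho_{XA}} I(X:B)_{(\mathrm{id}_X\otimes\mathcal P)(\rho_{XA})}, \] the supremum being over all classical--quantum states $\rho_{XA}=\sum_x p(x)\,|x\rangle\langle x|\otimes\rho_x$ with $x$ in a finite alphabet, $p$ a probability distribution and $\rho_x$ states on $H$. The coherent information is \[ I_c(\mathcal P)=\sup_{\rho_{A'A}} I(A'\rangle B)_{(\mathrm{id}_{A'}\otimes\mathcal P)(\rho_{A'A})}, \] the supremum being over all pure states $\rho_{A'A}$ on $H_{A'}\otimes H$ with $H_{A'}\cong H$. -/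

import Mathlib

open Filter Topology
open scoped Matrix Kronecker ComplexOrder

namespace QInfo

noncomputable section

/-- A state (density matrix) on the Hilbert space `ℂ^a`. -/
def IsState {a : Type*} [Fintype a] (ρ : Matrix a a ℂ) : Prop :=
  ρ.PosSemidef ∧ ρ.trace = 1

/-- A pure state `|ψ⟩⟨ψ|` with `ψ` a unit vector. -/
def IsPureState {a : Type*} [Fintype a] (ρ : Matrix a a ℂ) : Prop :=
  ∃ ψ : a → ℂ, star ψ ⬝ᵥ ψ = 1 ∧ ρ = Matrix.vecMulVec ψ (star ψ)

/-- The von Neumann entropy `H(ρ) = -tr(ρ log ρ)`. The logarithm is taken by functional calculus;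
since `Real.log 0 = 0`, the usual convention `0 log 0 = 0` is respected. -/
def entropy {a : Type*} [Fintype a] [DecidableEq a] (ρ : Matrix a a ℂ) : ℝ :=
  -(ρ * cfc Real.log ρ).trace.re

/-- The marginal `ω_A = tr_B ω_{AB}`. -/
def marginalA {a b : Type*} [Fintype b] (ω : Matrix (a × b) (a × b) ℂ) : Matrix a a ℂ :=
  Matrix.of fun i i' => ∑ j, ω (i, j) (i', j)

/-- The marginal `ω_B = tr_A ω_{AB}`. -/
def marginalB {a b : Type*} [Fintype a] (ω : Matrix (a × b) (a × b) ℂ) : Matrix b b ℂ :=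
  Matrix.of fun j j' => ∑ i, ω (i, j) (i, j')

/-- The quantum mutual information `I(A:B)_ω = H(ω_A) + H(ω_B) - H(ω_{AB})`. -/
def mutualInformation {a b : Type*} [Fintype a] [DecidableEq a] [Fintype b] [DecidableEq b]
    (ω : Matrix (a × b) (a × b) ℂ) : ℝ :=
  entropy (marginalA ω) + entropy (marginalB ω) - entropy ω

/-- The coherent information of a state, `I(A⟩B)_ω = H(ω_B) - H(ω_{AB})`. -/
def stateCoherentInformation {a b : Type*} [Fintype a] [DecidableEq a] [Fintype b] [DecidableEq b]
    (ω : Matrix (a × b) (a × b) ℂ) : ℝ :=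
  entropy (marginalB ω) - entropy ω

/-- The map `id_r ⊗ Φ`: regarding `M` as an `r × r` matrix of `n × n` blocks, apply `Φ` to each
block. -/
def idTensor (r : Type*) {n m : Type*} (Φ : Matrix n n ℂ →ₗ[ℂ] Matrix m m ℂ)
    (M : Matrix (r × n) (r × n) ℂ) : Matrix (r × m) (r × m) ℂ :=
  Matrix.of fun s t => Φ (Matrix.of fun i j => M (s.1, i) (t.1, j)) s.2 t.2

/-- The defining property of `id_r ⊗ Φ` on product operators. -/
theorem idTensor_kronecker (r : Type*) {n m : Type*} (Φ : Matrix n n ℂ →ₗ[ℂ] Matrix m m ℂ)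
    (A : Matrix r r ℂ) (B : Matrix n n ℂ) : idTensor r Φ (A ⊗ₖ B) = A ⊗ₖ Φ B := by
  ext ⟨a, i⟩ ⟨b, j⟩
  have h : (Matrix.of fun i' j' => (A ⊗ₖ B) (a, i') (b, j')) = A a b • B := by
    ext i' j'
    simp [Matrix.kroneckerMap_apply]
  simp only [idTensor, Matrix.of_apply]
  rw [h]
  simp [Matrix.kroneckerMap_apply]

/-- A quantum channel `B(ℂ^n) → B(ℂ^m)`: a completely positive trace-preserving linear map. -/
structure IsQuantumChannel {n m : Type*} [Fintype n] [Fintype m]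
    (Φ : Matrix n n ℂ →ₗ[ℂ] Matrix m m ℂ) : Prop where
  completelyPositive : ∀ (k : ℕ) (M : Matrix (Fin k × n) (Fin k × n) ℂ),
    M.PosSemidef → (idTensor (Fin k) Φ M).PosSemidef
  tracePreserving : ∀ X, (Φ X).trace = X.trace

/-- The peripheral subspace: the span of the eigenvectors of `Φ` with eigenvalue of modulus one. -/
def peripheralSubspace {n : Type*} (Φ : Matrix n n ℂ →ₗ[ℂ] Matrix n n ℂ) :
    Submodule ℂ (Matrix n n ℂ) :=
  Submodule.span ℂ {X | ∃ z : ℂ, ‖z‖ = 1 ∧ Φ X = z • X}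

/-- `P` is the peripheral projection of `Φ`: its range is the peripheral subspace, it fixes that
subspace pointwise, and it is the limit of a sequence of powers of `Φ` with non-decreasing
exponents (in finite dimension pointwise convergence is norm convergence). -/
structure IsPeripheralProjection {n : Type*} (Φ P : Matrix n n ℂ →ₗ[ℂ] Matrix n n ℂ) : Prop where
  range_eq : LinearMap.range P = peripheralSubspace Φ
  exists_tendsto : ∃ e : ℕ → ℕ, Monotone e ∧
    ∀ X, Tendsto (fun i => (Φ ^ e i) X) atTop (𝓝 (P X))
  fixes : ∀ X ∈ peripheralSubspace Φ, P X = X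

/-- The classical-quantum state `∑ x, p(x) |x⟩⟨x| ⊗ ρ_x`. -/
def cqState {N : ℕ} {n : Type*} (p : Fin N → ℝ) (ρ : Fin N → Matrix n n ℂ) :
    Matrix (Fin N × n) (Fin N × n) ℂ :=
  ∑ x, (p x : ℂ) • (Matrix.single x x (1 : ℂ) ⊗ₖ ρ x)

/-- A finite ensemble of states on `ℂ^n` indexed by an `N`-letter alphabet. -/
structure Ensemble (N : ℕ) (n : Type*) [Fintype n] where
  p : Fin N → ℝ
  p_nonneg : ∀ x, 0 ≤ p x
  p_sum : ∑ x, p x = 1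
  ρ : Fin N → Matrix n n ℂ
  ρ_isState : ∀ x, IsState (ρ x)

/-- The Holevo quantity `χ(Φ) = sup I(X:B)_{(id_X ⊗ Φ)(ρ_{XA})}` over all classical-quantum states
`ρ_{XA}` with a finite alphabet. The supremum is taken in `[-∞, ∞]`. -/
def holevoQuantity {n m : Type*} [Fintype n] [Fintype m] [DecidableEq m]
    (Φ : Matrix n n ℂ →ₗ[ℂ] Matrix m m ℂ) : EReal :=
  ⨆ (N : ℕ) (E : Ensemble N n),
    ((mutualInformation (idTensor (Fin N) Φ (cqState E.p E.ρ)) : ℝ) : EReal)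

/-- The coherent information `I_c(Φ) = sup I(A'⟩B)_{(id_{A'} ⊗ Φ)(ρ_{A'A})}` over all pure states
`ρ_{A'A}` with `H_{A'} ≅ H_A`. The supremum is taken in `[-∞, ∞]`. -/
def coherentInformation {n m : Type*} [Fintype n] [DecidableEq n] [Fintype m] [DecidableEq m]
    (Φ : Matrix n n ℂ →ₗ[ℂ] Matrix m m ℂ) : EReal :=
  ⨆ (ρ : Matrix (n × n) (n × n) ℂ) (_ : IsPureState ρ),
    ((stateCoherentInformation (idTensor n Φ ρ) : ℝ) : EReal)

/-- The subspace `0 ⊕ ⨁ k, M_{d k} ⊗ ω k` of `B(ℂ^n)`, as a set. The decomposition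
`ℂ^n = H₀ ⊕ ⨁ k, ℂ^{d k} ⊗ ℂ^{m k}` is given by the isometry `V` from `⨁ k, ℂ^{d k} ⊗ ℂ^{m k}`
into `ℂ^n`, with `H₀` the orthogonal complement of the range of `V`. -/
def blockSubspace {n : Type*} {K : ℕ} {d m : Fin K → ℕ}
    (V : Matrix n (Σ k, Fin (d k) × Fin (m k)) ℂ)
    (ω : ∀ k, Matrix (Fin (m k)) (Fin (m k)) ℂ) : Set (Matrix n n ℂ) :=
  {Y | ∃ X : ∀ k, Matrix (Fin (d k)) (Fin (d k)) ℂ,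
    Y = V * Matrix.blockDiagonal' (fun k => X k ⊗ₖ ω k) * Vᴴ}

end

end QInfo

namespace QInfo

/-! ### Entropy of Hermitian matrices -/

/-! The projection `P` inherits complete positivity and trace preservation from the powers of `Φ`;
its outputs are the block operators `⨁ X_k ⊗ ω_k`, and it fixes all of them. By `entropy_embed` such
an operator has entropy `∑ (H(X_k) + tr X_k · H(ω_k))`, where the `X_k` need not be normalised. The
part involving `H(ω_k)` is linear in `X_k`, so it cancels in both information quantities and only
the `X_k` matter.

Holevo quantity: the subtracted conditional entropies are nonnegative, and the blocks of the
averaged output have together `∑ d_k` eigenvalues of sum one, so Jensen bounds their entropy by `log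
∑ d_k`. The uniform ensemble over the basis projections of all left factors attains this.

Coherent information: for a positive `X_k` on reference and left factor, the upper bound
`entropy_le` for the marginal and the lower bound `negMulLog_trace_le_entropy` for `X_k` differ by
`tr X_k · log d_k`. The traces sum to one, hence the bound `log max d_k`. To attain it one wants the
output `F ⊗ ω_k` with `F` maximally entangled on a largest block. That operator is fixed but
generally mixed, while inputs must be pure. `exists_pure_idTensor_eq` therefore feeds in a pure
state dominated by a multiple of `F ⊗ ω_k`; positivity and trace preservation force the desired
output. -/

theorem entropy_eq_sum_eigenvalues {a : Type*} [Fintype a] [DecidableEq a] {M : Matrix a a ℂ}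
    (hM : M.IsHermitian) : entropy M = ∑ i, Real.negMulLog (hM.eigenvalues i) := by
  have hU : (star (hM.eigenvectorUnitary : Matrix a a ℂ)) * hM.eigenvectorUnitary = 1 :=
    Unitary.coe_star_mul_self _
  have h : M * cfc Real.log M = hM.eigenvectorUnitary *
      Matrix.diagonal (fun i => ((hM.eigenvalues i * Real.log (hM.eigenvalues i) : ℝ) : ℂ)) *
      star (hM.eigenvectorUnitary : Matrix a a ℂ) := by
    rw [hM.cfc_eq, Matrix.IsHermitian.cfc]
    conv_lhs => enter [1]; rw [hM.spectral_theorem]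
    rw [← map_mul, Matrix.diagonal_mul_diagonal, Unitary.conjStarAlgAut_apply]
    simp
  rw [entropy, h, Matrix.trace_mul_comm, ← Matrix.mul_assoc, hU, one_mul, Matrix.trace_diagonal]
  simp only [Complex.re_sum, Complex.ofReal_re, Real.negMulLog_def, neg_mul,
    Finset.sum_neg_distrib]

/-- Makes entropy a function of the characteristic polynomial, so matrices of different sizes can be
compared. -/
theorem entropy_eq_sum_roots_charpoly {a : Type*} [Fintype a] [DecidableEq a] {M : Matrix a a ℂ}
    (hM : M.IsHermitian) :
    entropy M = (M.charpoly.roots.map fun z => Real.negMulLog z.re).sum := by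
  rw [entropy_eq_sum_eigenvalues hM, hM.roots_charpoly_eq_eigenvalues, Multiset.map_map]
  rfl

/-- Entropy is invariant under swapping the factors of a product of rectangular matrices. -/
theorem entropy_mul_comm {a b : Type*} [Fintype a] [DecidableEq a] [Fintype b] [DecidableEq b]
    (A : Matrix a b ℂ) (B : Matrix b a ℂ) (hAB : (A * B).IsHermitian) (hBA : (B * A).IsHermitian) :
    entropy (A * B) = entropy (B * A) := by
  -- The characteristic polynomials of `A * B` and `B * A` agree up to powers of `X`; the extra
  -- roots are zero and contribute `negMulLog 0 = 0`.
  have key := congrArg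
    (fun p : Polynomial ℂ => (p.roots.map fun z : ℂ => Real.negMulLog z.re).sum)
    (Matrix.charpoly_mul_comm' A B)
  have h (k : ℕ) (p : Polynomial ℂ) (hp : p.Monic) :
      ((Polynomial.X ^ k * p).roots.map fun z : ℂ => Real.negMulLog z.re).sum =
        (p.roots.map fun z : ℂ => Real.negMulLog z.re).sum := by
    rw [Polynomial.roots_mul (mul_ne_zero (pow_ne_zero _ Polynomial.X_ne_zero) hp.ne_zero),
      Polynomial.roots_X_pow]
    simp [Multiset.nsmul_singleton]
  simp only [h _ _ (Matrix.charpoly_monic _)] at key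
  rw [entropy_eq_sum_roots_charpoly hAB, entropy_eq_sum_roots_charpoly hBA, key]

theorem entropy_isometry_conj {a b : Type*} [Fintype a] [DecidableEq a] [Fintype b]
    [DecidableEq b] {V : Matrix a b ℂ} (hV : Vᴴ * V = 1) {M : Matrix b b ℂ} (hM : M.IsHermitian) :
    entropy (V * M * Vᴴ) = entropy M := by
  have h : Vᴴ * (V * M) = M := by rw [← Matrix.mul_assoc, hV, Matrix.one_mul]
  rw [entropy_mul_comm _ _ (Matrix.isHermitian_mul_mul_conjTranspose _ hM) (by rwa [h]), h]

theorem entropy_diagonal {a : Type*} [Fintype a] [DecidableEq a] (l : a → ℝ) :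
    entropy (Matrix.diagonal fun i => (l i : ℂ)) = ∑ i, Real.negMulLog (l i) := by
  rw [entropy_eq_sum_roots_charpoly (Matrix.isHermitian_diagonal_of_self_adjoint _ (by
      ext i; simp)), Matrix.charpoly_diagonal, Polynomial.roots_prod]
  · simp
  · simp [Finset.prod_ne_zero_iff, Polynomial.X_sub_C_ne_zero]

theorem exists_eq_conj_diagonal {a : Type*} [Fintype a] [DecidableEq a] {M : Matrix a a ℂ}
    (hM : M.IsHermitian) : ∃ (U : Matrix a a ℂ) (l : a → ℝ), Uᴴ * U = 1 ∧
      M = U * Matrix.diagonal (fun i => (l i : ℂ)) * Uᴴ := by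
  refine ⟨hM.eigenvectorUnitary, hM.eigenvalues, Unitary.coe_star_mul_self _, ?_⟩
  conv_lhs => rw [hM.spectral_theorem, Unitary.conjStarAlgAut_apply]
  rfl

theorem isHermitian_diagonal_ofReal {a : Type*} [DecidableEq a] (l : a → ℝ) :
    (Matrix.diagonal fun i => (l i : ℂ)).IsHermitian :=
  Matrix.isHermitian_diagonal_of_self_adjoint _ (by ext i; simp)

theorem trace_conj_diagonal {a : Type*} [Fintype a] [DecidableEq a] {M U : Matrix a a ℂ}
    {l : a → ℝ} (hU : Uᴴ * U = 1) (hM : M = U * Matrix.diagonal (fun i => (l i : ℂ)) * Uᴴ) :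
    M.trace = ((∑ i, l i : ℝ) : ℂ) := by
  rw [hM, Matrix.trace_mul_comm, ← Matrix.mul_assoc, hU, Matrix.one_mul, Matrix.trace_diagonal]
  simp

theorem isHermitian_blockDiagonal' {ι : Type*} [DecidableEq ι] {g : ι → Type*}
    {M : ∀ k, Matrix (g k) (g k) ℂ}
    (h : ∀ k, (M k).IsHermitian) : (Matrix.blockDiagonal' M).IsHermitian := by
  rw [Matrix.IsHermitian, Matrix.blockDiagonal'_conjTranspose]
  exact congrArg _ (funext h)

theorem isHermitian_kronecker {α β : Type*} {A : Matrix α α ℂ} {B : Matrix β β ℂ}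
    (hA : A.IsHermitian) (hB : B.IsHermitian) : (A ⊗ₖ B).IsHermitian := by
  rw [Matrix.IsHermitian, Matrix.conjTranspose_kronecker, hA, hB]

/-- Jensen for the concave `negMulLog` with uniform weights. No normalisation is assumed, because it
is applied to single blocks, whose traces are at most one. -/
theorem sum_negMulLog_le {a : Type*} [Fintype a] (l : a → ℝ) (hl : ∀ i, 0 ≤ l i) :
    ∑ i, Real.negMulLog (l i) ≤
      Real.negMulLog (∑ i, l i) + (∑ i, l i) * Real.log (Fintype.card a) := by
  rcases isEmpty_or_nonempty a with h | h
  · simp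
  have hD : (0 : ℝ) < Fintype.card a := by exact_mod_cast Fintype.card_pos
  have key := Real.concaveOn_negMulLog.le_map_sum (t := Finset.univ) (p := l)
    (w := fun _ => (Fintype.card a : ℝ)⁻¹) (fun _ _ => by positivity)
    (by simp [hD.ne']) (fun i _ => hl i)
  simp only [smul_eq_mul, ← Finset.mul_sum] at key
  rw [Real.negMulLog_mul, inv_mul_le_iff₀ hD] at key
  refine key.trans (le_of_eq ?_)
  rw [Real.negMulLog, Real.log_inv]
  field_simp
  ring

/-- Each term is at most the total, and `log` is monotone on positive reals. -/
theorem negMulLog_sum_le {a : Type*} [Fintype a] (l : a → ℝ) (hl : ∀ i, 0 ≤ l i) :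
    Real.negMulLog (∑ i, l i) ≤ ∑ i, Real.negMulLog (l i) := by
  simp only [Real.negMulLog, neg_mul, Finset.sum_neg_distrib, neg_le_neg_iff, Finset.sum_mul]
  refine Finset.sum_le_sum fun i hi => ?_
  rcases (hl i).eq_or_lt with h | h
  · simp [← h]
  · exact mul_le_mul_of_nonneg_left
      (Real.log_le_log h (Finset.single_le_sum (fun j _ => hl j) hi)) (hl i)

theorem sum_eigenvalues_eq_trace_re {a : Type*} [Fintype a] [DecidableEq a] {M : Matrix a a ℂ}
    (hM : M.IsHermitian) : ∑ i, hM.eigenvalues i = M.trace.re := by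
  rw [hM.trace_eq_sum_eigenvalues]
  simp

theorem entropy_le {a : Type*} [Fintype a] [DecidableEq a] {M : Matrix a a ℂ}
    (hM : M.PosSemidef) :
    entropy M ≤ Real.negMulLog M.trace.re + M.trace.re * Real.log (Fintype.card a) := by
  rw [entropy_eq_sum_eigenvalues hM.1, ← sum_eigenvalues_eq_trace_re hM.1]
  exact sum_negMulLog_le _ hM.eigenvalues_nonneg

theorem negMulLog_trace_le_entropy {a : Type*} [Fintype a] [DecidableEq a] {M : Matrix a a ℂ}
    (hM : M.PosSemidef) : Real.negMulLog M.trace.re ≤ entropy M := by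
  rw [entropy_eq_sum_eigenvalues hM.1, ← sum_eigenvalues_eq_trace_re hM.1]
  exact negMulLog_sum_le _ hM.eigenvalues_nonneg

theorem trace_re_nonneg {a : Type*} [Fintype a] {M : Matrix a a ℂ} (hM : M.PosSemidef) :
    0 ≤ M.trace.re := (Complex.nonneg_iff.mp hM.trace_nonneg).1

/-! ### Block operators `V (⨁ k, X k ⊗ ω k) Vᴴ` -/

/-- The operator `V (⨁ k, X k ⊗ ω k) Vᴴ`. -/
noncomputable def embed {a ι : Type*} {e f : ι → Type*} [Fintype ι] [DecidableEq ι]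
    [∀ k, Fintype (e k)] [∀ k, Fintype (f k)] (V : Matrix a (Σ k, e k × f k) ℂ)
    (X : ∀ k, Matrix (e k) (e k) ℂ) (ω : ∀ k, Matrix (f k) (f k) ℂ) : Matrix a a ℂ :=
  V * Matrix.blockDiagonal' (fun k => X k ⊗ₖ ω k) * Vᴴ

section embed

variable {a ι : Type*} {e f : ι → Type*} [Fintype ι] [DecidableEq ι]
    [∀ k, Fintype (e k)] [∀ k, Fintype (f k)]

theorem embed_sum {σ : Type*} (s : Finset σ) (V : Matrix a (Σ k, e k × f k) ℂ)
    (X : σ → ∀ k, Matrix (e k) (e k) ℂ) (ω : ∀ k, Matrix (f k) (f k) ℂ) :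
    ∑ x ∈ s, embed V (X x) ω = embed V (fun k => ∑ x ∈ s, X x k) ω := by
  simp only [embed, ← Matrix.sum_mul, ← Matrix.mul_sum]
  congr 2
  ext ⟨k, i⟩ ⟨l, j⟩
  rw [Matrix.sum_apply]
  by_cases h : k = l
  · subst h
    simp [Matrix.blockDiagonal'_apply_eq, Matrix.sum_apply, Finset.sum_mul]
  · simp [Matrix.blockDiagonal'_apply_ne _ _ _ h]

theorem embed_smul (c : ℂ) (V : Matrix a (Σ k, e k × f k) ℂ)
    (X : ∀ k, Matrix (e k) (e k) ℂ) (ω : ∀ k, Matrix (f k) (f k) ℂ) :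
    c • embed V X ω = embed V (fun k => c • X k) ω := by
  simp only [embed, Matrix.smul_kronecker]
  rw [show (fun k => c • X k ⊗ₖ ω k) = c • fun k => X k ⊗ₖ ω k from rfl,
    Matrix.blockDiagonal'_smul, Matrix.mul_smul, Matrix.smul_mul]

theorem embed_sub (V : Matrix a (Σ k, e k × f k) ℂ)
    (X Y : ∀ k, Matrix (e k) (e k) ℂ) (ω : ∀ k, Matrix (f k) (f k) ℂ) :
    embed V X ω - embed V Y ω = embed V (fun k => X k - Y k) ω := by
  simp only [embed, ← Matrix.mul_sub, ← Matrix.sub_mul, ← Matrix.blockDiagonal'_sub]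
  congr 3
  funext k
  ext ⟨i, j⟩ ⟨i', j'⟩
  simp [sub_mul]

theorem trace_embed [Fintype a] [∀ k, DecidableEq (e k)] [∀ k, DecidableEq (f k)]
    {V : Matrix a (Σ k, e k × f k) ℂ} (hV : Vᴴ * V = 1)
    (X : ∀ k, Matrix (e k) (e k) ℂ) {ω : ∀ k, Matrix (f k) (f k) ℂ} (hω : ∀ k, (ω k).trace = 1) :
    (embed V X ω).trace = ∑ k, (X k).trace := by
  rw [embed, Matrix.trace_mul_comm, ← Matrix.mul_assoc, hV, Matrix.one_mul, Matrix.trace_blockDiagonal']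
  simp [Matrix.trace_kronecker, hω]

/-- Compressing by `V` and tracing out the right factor of block `k` returns `X k`, as `ω k` has
trace one; this partial trace is a sum of principal submatrices. -/
theorem posSemidef_of_embed [Fintype a] [∀ k, DecidableEq (e k)] [∀ k, DecidableEq (f k)]
    {V : Matrix a (Σ k, e k × f k) ℂ} (hV : Vᴴ * V = 1)
    {X : ∀ k, Matrix (e k) (e k) ℂ} {ω : ∀ k, Matrix (f k) (f k) ℂ} (hω : ∀ k, (ω k).trace = 1)
    (h : (embed V X ω).PosSemidef) (k : ι) : (X k).PosSemidef := by
  have h1 := h.conjTranspose_mul_mul_same V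
  have h2 : Vᴴ * embed V X ω * V = Matrix.blockDiagonal' (fun k => X k ⊗ₖ ω k) := by
    rw [embed, ← Matrix.mul_assoc, ← Matrix.mul_assoc, hV, Matrix.one_mul, Matrix.mul_assoc, hV, Matrix.mul_one]
  rw [h2] at h1
  have h3 : X k = ∑ j, (Matrix.blockDiagonal' (fun k => X k ⊗ₖ ω k)).submatrix
      (fun i : e k => (⟨k, i, j⟩ : Σ k, e k × f k)) (fun i => ⟨k, i, j⟩) := by
    ext i i'
    have := hω k
    simp only [Matrix.trace, Matrix.diag] at this
    simp [Matrix.sum_apply, Matrix.blockDiagonal'_apply_eq, ← Finset.mul_sum, this]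
  rw [h3]
  exact Matrix.posSemidef_sum _ fun j _ => h1.submatrix _

/-- Entropy of a block operator with normalized right tensor factors. -/
theorem entropy_embed [Fintype a] [DecidableEq a] [∀ k, DecidableEq (e k)]
    [∀ k, DecidableEq (f k)] {V : Matrix a (Σ k, e k × f k) ℂ} (hV : Vᴴ * V = 1)
    {X : ∀ k, Matrix (e k) (e k) ℂ} (hX : ∀ k, (X k).IsHermitian)
    {ω : ∀ k, Matrix (f k) (f k) ℂ} (hω : ∀ k, (ω k).IsHermitian) (hω1 : ∀ k, (ω k).trace = 1) :
    entropy (embed V X ω) = ∑ k, (entropy (X k) + (X k).trace.re * entropy (ω k)) := by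
  rw [embed, entropy_isometry_conj hV
    (isHermitian_blockDiagonal' fun k => isHermitian_kronecker (hX k) (hω k))]
  choose U l hU hUX using fun k => exists_eq_conj_diagonal (hX k)
  choose W μ hW hWω using fun k => exists_eq_conj_diagonal (hω k)
  -- Diagonalising both factors in every block shows that the eigenvalues are the products `l k i *
  -- μ k j`.
  have h1 : Matrix.blockDiagonal' (fun k => X k ⊗ₖ ω k) =
      Matrix.blockDiagonal' (fun k => U k ⊗ₖ W k) *
        Matrix.diagonal (fun s : Σ k, e k × f k => ((l s.1 s.2.1 * μ s.1 s.2.2 : ℝ) : ℂ)) *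
        (Matrix.blockDiagonal' (fun k => U k ⊗ₖ W k))ᴴ := by
    have : Matrix.diagonal (fun s : Σ k, e k × f k => ((l s.1 s.2.1 * μ s.1 s.2.2 : ℝ) : ℂ)) =
        Matrix.blockDiagonal' (fun k => Matrix.diagonal (fun i => (l k i : ℂ)) ⊗ₖ
          Matrix.diagonal (fun i => (μ k i : ℂ))) := by
      simp only [Matrix.diagonal_kronecker_diagonal, Matrix.blockDiagonal'_diagonal]
      simp
    rw [this, Matrix.blockDiagonal'_conjTranspose, ← Matrix.blockDiagonal'_mul,
      ← Matrix.blockDiagonal'_mul]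
    congr 1
    funext k
    rw [Matrix.conjTranspose_kronecker, ← Matrix.mul_kronecker_mul, ← Matrix.mul_kronecker_mul,
      ← hUX, ← hWω]
  have h2 : (Matrix.blockDiagonal' (fun k => U k ⊗ₖ W k))ᴴ *
      Matrix.blockDiagonal' (fun k => U k ⊗ₖ W k) = 1 := by
    rw [Matrix.blockDiagonal'_conjTranspose, ← Matrix.blockDiagonal'_mul]
    simp only [Matrix.conjTranspose_kronecker, ← Matrix.mul_kronecker_mul, hU, hW,
      Matrix.one_kronecker_one]
    exact Matrix.blockDiagonal'_one
  rw [h1, entropy_isometry_conj h2 (isHermitian_diagonal_ofReal _), entropy_diagonal,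
    Fintype.sum_sigma]
  refine Finset.sum_congr rfl fun k _ => ?_
  have hμ : ∑ j, μ k j = 1 := by
    have := trace_conj_diagonal (hW k) (hWω k)
    rw [hω1] at this
    exact_mod_cast this.symm
  have ht : (X k).trace.re = ∑ i, l k i := by rw [trace_conj_diagonal (hU k) (hUX k), Complex.ofReal_re]
  have e1 : entropy (X k) = ∑ i, Real.negMulLog (l k i) := by
    rw [hUX k, entropy_isometry_conj (hU k) (isHermitian_diagonal_ofReal _), entropy_diagonal]
  have e2 : entropy (ω k) = ∑ i, Real.negMulLog (μ k i) := by
    rw [hWω k, entropy_isometry_conj (hW k) (isHermitian_diagonal_ofReal _), entropy_diagonal]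
  simp only [Fintype.sum_prod_type, Real.negMulLog_mul, Finset.sum_add_distrib, ← Finset.sum_mul,
    ← Finset.mul_sum, hμ, one_mul, ht, e1, e2]

end embed

/-! ### Limits of powers of channels -/

theorem posSemidef_of_tendsto {a : Type*} [Fintype a] {M : ℕ → Matrix a a ℂ} {L : Matrix a a ℂ}
    (hM : ∀ i, (M i).PosSemidef) (h : Tendsto M atTop (𝓝 L)) : L.PosSemidef := by
  refine Matrix.PosSemidef.of_dotProduct_mulVec_nonneg ?_ fun x => ?_
  · refine tendsto_nhds_unique ?_ h
    have := ((continuous_id.matrix_conjTranspose).tendsto L).comp h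
    exact this.congr fun i => (hM i).1
  · have hc : Continuous fun A : Matrix a a ℂ => star x ⬝ᵥ A *ᵥ x := by fun_prop
    exact ge_of_tendsto' ((hc.tendsto L).comp h) fun i => (hM i).dotProduct_mulVec_nonneg x

theorem idTensor_comp (r : Type*) {n : Type*} (Φ Ψ : Matrix n n ℂ →ₗ[ℂ] Matrix n n ℂ)
    (M : Matrix (r × n) (r × n) ℂ) : idTensor r (Φ * Ψ) M = idTensor r Φ (idTensor r Ψ M) := rfl

theorem IsQuantumChannel.posSemidef_idTensor_pow {n : Type*} [Fintype n]
    {Φ : Matrix n n ℂ →ₗ[ℂ] Matrix n n ℂ} (hΦ : IsQuantumChannel Φ) (k e : ℕ)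
    {M : Matrix (Fin k × n) (Fin k × n) ℂ} (hM : M.PosSemidef) :
    (idTensor (Fin k) (Φ ^ e) M).PosSemidef := by
  induction e with
  | zero => exact hM
  | succ e ih =>
    rw [pow_succ', idTensor_comp]
    exact hΦ.completelyPositive k _ ih

theorem IsQuantumChannel.trace_pow {n : Type*} [Fintype n]
    {Φ : Matrix n n ℂ →ₗ[ℂ] Matrix n n ℂ} (hΦ : IsQuantumChannel Φ) (e : ℕ) (X : Matrix n n ℂ) :
    ((Φ ^ e) X).trace = X.trace := by
  induction e with
  | zero => rfl
  | succ e ih => rw [pow_succ', Module.End.mul_apply, hΦ.tracePreserving, ih]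

/-- The peripheral projection of a quantum channel is a quantum channel. -/
theorem IsPeripheralProjection.isQuantumChannel {n : Type*} [Fintype n]
    {Φ P : Matrix n n ℂ →ₗ[ℂ] Matrix n n ℂ} (hP : IsPeripheralProjection Φ P)
    (hΦ : IsQuantumChannel Φ) : IsQuantumChannel P := by
  obtain ⟨e, -, he⟩ := hP.exists_tendsto
  constructor
  · intro k M hM
    refine posSemidef_of_tendsto (fun i => hΦ.posSemidef_idTensor_pow k (e i) hM) ?_
    -- Each entry of `idTensor` is an entry of the map applied to one block of `M`, so pointwise
    -- convergence suffices.
    refine tendsto_pi_nhds.2 fun s => tendsto_pi_nhds.2 fun t => ?_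
    exact tendsto_pi_nhds.1 (tendsto_pi_nhds.1
      (he (Matrix.of fun i j => M (s.1, i) (t.1, j))) s.2) t.2
  · intro X
    have hc : Continuous fun A : Matrix n n ℂ => A.trace := by fun_prop
    refine tendsto_nhds_unique ((hc.tendsto _).comp (he X)) ?_
    simp only [Function.comp_def, hΦ.trace_pow, tendsto_const_nhds]

/-- Complete positivity with an arbitrary finite reference system. -/
theorem IsQuantumChannel.posSemidef_idTensor {n m r : Type*} [Fintype n] [Fintype m] [Fintype r]
    {Φ : Matrix n n ℂ →ₗ[ℂ] Matrix m m ℂ} (hΦ : IsQuantumChannel Φ)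
    {M : Matrix (r × n) (r × n) ℂ} (hM : M.PosSemidef) : (idTensor r Φ M).PosSemidef := by
  have h := hΦ.completelyPositive _ _
    (hM.submatrix fun s : Fin (Fintype.card r) × n => ((Fintype.equivFin r).symm s.1, s.2))
  have h2 := h.submatrix fun s : r × m => (Fintype.equivFin r s.1, s.2)
  convert h2 using 1
  ext s t
  simp only [idTensor, Matrix.of_apply, Matrix.submatrix_apply, Equiv.symm_apply_apply]

theorem IsQuantumChannel.posSemidef_apply {n m : Type*} [Fintype n] [Fintype m]
    {Φ : Matrix n n ℂ →ₗ[ℂ] Matrix m m ℂ} (hΦ : IsQuantumChannel Φ)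
    {M : Matrix n n ℂ} (hM : M.PosSemidef) : (Φ M).PosSemidef :=
  (hΦ.posSemidef_idTensor (r := Unit) (hM.submatrix Prod.snd)).submatrix (fun i => ((), i))

theorem IsQuantumChannel.trace_idTensor {n m r : Type*} [Fintype n] [Fintype m] [Fintype r]
    {Φ : Matrix n n ℂ →ₗ[ℂ] Matrix m m ℂ} (hΦ : IsQuantumChannel Φ)
    (M : Matrix (r × n) (r × n) ℂ) : (idTensor r Φ M).trace = M.trace := by
  simp only [Matrix.trace, Matrix.diag, Fintype.sum_prod_type, idTensor, Matrix.of_apply]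
  exact Finset.sum_congr rfl fun s _ =>
    hΦ.tracePreserving (Matrix.of fun i j => M (s, i) (s, j))

theorem idTensor_sub (r : Type*) {n m : Type*} (Φ : Matrix n n ℂ →ₗ[ℂ] Matrix m m ℂ)
    (M N : Matrix (r × n) (r × n) ℂ) :
    idTensor r Φ (M - N) = idTensor r Φ M - idTensor r Φ N := by
  ext s t
  exact congrFun (congrFun (map_sub Φ (Matrix.of fun i j => M (s.1, i) (t.1, j))
    (Matrix.of fun i j => N (s.1, i) (t.1, j))) s.2) t.2

theorem idTensor_smul (r : Type*) {n m : Type*} (Φ : Matrix n n ℂ →ₗ[ℂ] Matrix m m ℂ) (c : ℂ)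
    (M : Matrix (r × n) (r × n) ℂ) : idTensor r Φ (c • M) = c • idTensor r Φ M := by
  ext s t
  exact congrFun (congrFun (map_smul Φ c (Matrix.of fun i j => M (s.1, i) (t.1, j))) s.2) t.2

theorem idTensor_cqState {N : ℕ} {n m : Type*} (Φ : Matrix n n ℂ →ₗ[ℂ] Matrix m m ℂ)
    (p : Fin N → ℝ) (ρ : Fin N → Matrix n n ℂ) :
    idTensor (Fin N) Φ (cqState p ρ) = cqState p fun x => Φ (ρ x) := by
  let L : Matrix (Fin N × n) (Fin N × n) ℂ →+ Matrix (Fin N × m) (Fin N × m) ℂ :=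
    AddMonoidHom.ofMapSub (idTensor (Fin N) Φ) (idTensor_sub _ _)
  change L _ = _
  simp only [cqState, map_sum]
  refine Finset.sum_congr rfl fun x _ => ?_
  change idTensor _ _ _ = _
  rw [idTensor_smul, idTensor_kronecker]

/-! ### Block operators with a reference system -/

/-- The operator `1_r ⊗ V`, with the reference system absorbed in the left tensor factors. -/
def refTensor (r : Type*) [DecidableEq r] {a ι : Type*} {e f : ι → Type*}
    (V : Matrix a (Σ k, e k × f k) ℂ) : Matrix (r × a) (Σ k, (r × e k) × f k) ℂ :=
  Matrix.of fun s t => if s.1 = t.2.1.1 then V s.2 ⟨t.1, t.2.1.2, t.2.2⟩ else 0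

section refTensor

set_option linter.unusedSectionVars false

variable {r a ι : Type*} {e f : ι → Type*} [Fintype ι] [DecidableEq ι] [Fintype r] [DecidableEq r]
    [∀ k, Fintype (e k)] [∀ k, Fintype (f k)]

theorem sum_refIndex (F : (Σ k, (r × e k) × f k) → ℂ) :
    ∑ t, F t = ∑ s : r, ∑ u : Σ k, e k × f k, F ⟨u.1, (s, u.2.1), u.2.2⟩ := by
  simp only [Fintype.sum_sigma, Fintype.sum_prod_type]
  exact Finset.sum_comm

theorem refTensor_isometry [Fintype a] [∀ k, DecidableEq (e k)] [∀ k, DecidableEq (f k)]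
    {V : Matrix a (Σ k, e k × f k) ℂ} (hV : Vᴴ * V = 1) :
    (refTensor r V)ᴴ * refTensor r V = 1 := by
  ext ⟨k, ⟨s, i⟩, j⟩ ⟨l, ⟨t, i'⟩, j'⟩
  have h := congrFun (congrFun hV ⟨k, i, j⟩) ⟨l, i', j'⟩
  simp only [Matrix.mul_apply, Matrix.conjTranspose_apply] at h
  simp only [Matrix.mul_apply, Matrix.conjTranspose_apply, refTensor, Matrix.of_apply,
    Fintype.sum_prod_type, apply_ite star, star_zero, ite_mul, zero_mul, mul_ite, mul_zero]
  rw [Finset.sum_eq_single s (fun u _ hu => by simp [hu]) (by simp)]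
  by_cases hst : s = t
  · subst hst
    simp only [if_true]
    rw [h, Matrix.one_apply, Matrix.one_apply]
    congr 1
    simp only [Sigma.mk.injEq, eq_iff_iff]
    refine and_congr_right fun hkl => ?_
    subst hkl
    simp
  · have : (⟨k, (s, i), j⟩ : Σ k, (r × e k) × f k) ≠ ⟨l, (t, i'), j'⟩ := by
      intro h
      simp only [Sigma.mk.injEq] at h
      obtain ⟨rfl, h⟩ := h
      simp only [heq_eq_eq, Prod.mk.injEq] at h
      exact hst h.1.1
    rw [Matrix.one_apply_ne this]
    simp [hst]

/-- Fixing reference indices leaves a block operator for `V` itself, which reduces claims about `id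
⊗ P` to claims about `P`. -/
theorem embed_refTensor_apply (V : Matrix a (Σ k, e k × f k) ℂ)
    (X : ∀ k, Matrix (r × e k) (r × e k) ℂ) (ω : ∀ k, Matrix (f k) (f k) ℂ) (s t : r) (i j : a) :
    embed (refTensor r V) X ω (s, i) (t, j) =
      embed V (fun k => Matrix.of fun x y => X k (s, x) (t, y)) ω i j := by
  have h (u v : Σ k, e k × f k) :
      Matrix.blockDiagonal' (fun k => X k ⊗ₖ ω k) ⟨u.1, (s, u.2.1), u.2.2⟩
        ⟨v.1, (t, v.2.1), v.2.2⟩ =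
      Matrix.blockDiagonal' (fun k => (Matrix.of fun x y => X k (s, x) (t, y)) ⊗ₖ ω k) u v := by
    obtain ⟨k, x, y⟩ := u
    obtain ⟨l, x', y'⟩ := v
    by_cases h : k = l
    · subst h
      simp [Matrix.blockDiagonal'_apply_eq]
    · simp [Matrix.blockDiagonal'_apply_ne _ _ _ h]
  simp only [embed, Matrix.mul_apply, Matrix.conjTranspose_apply]
  rw [sum_refIndex, Finset.sum_eq_single t]
  · refine Finset.sum_congr rfl fun v _ => ?_
    rw [sum_refIndex, Finset.sum_eq_single s]
    · simp [refTensor, h]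
    · intro u _ hu
      simp [refTensor, hu.symm]
    · simp
  · intro u _ hu
    simp [refTensor, hu.symm]
  · simp

theorem marginalB_embed_refTensor (V : Matrix a (Σ k, e k × f k) ℂ)
    (X : ∀ k, Matrix (r × e k) (r × e k) ℂ) (ω : ∀ k, Matrix (f k) (f k) ℂ) :
    marginalB (embed (refTensor r V) X ω) = embed V (fun k => marginalB (X k)) ω := by
  have h : (fun k => marginalB (X k)) = fun k => ∑ s : r,
      (Matrix.of fun x y => X k (s, x) (s, y) : Matrix (e k) (e k) ℂ) := by
    funext k
    ext x y
    simp [marginalB, Matrix.sum_apply]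
  rw [h, ← embed_sum Finset.univ V
    (fun s k => (Matrix.of fun x y => X k (s, x) (s, y) : Matrix (e k) (e k) ℂ))]
  ext i j
  simp only [marginalB, Matrix.of_apply, embed_refTensor_apply, Matrix.sum_apply]

end refTensor

theorem trace_marginalB {a b : Type*} [Fintype a] [Fintype b] (M : Matrix (a × b) (a × b) ℂ) :
    (marginalB M).trace = M.trace := by
  simp only [Matrix.trace, Matrix.diag, marginalB, Matrix.of_apply, Fintype.sum_prod_type]
  exact Finset.sum_comm

theorem posSemidef_marginalB {a b : Type*} [Fintype a] [Fintype b]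
    {M : Matrix (a × b) (a × b) ℂ} (hM : M.PosSemidef) : (marginalB M).PosSemidef := by
  have : marginalB M = ∑ s, M.submatrix (fun i => (s, i)) (fun i => (s, i)) := by
    ext i j
    simp [marginalB, Matrix.sum_apply]
  rw [this]
  exact Matrix.posSemidef_sum _ fun s _ => hM.submatrix _

/-- The coherent information of a block operator. -/
theorem stateCoherentInformation_embed {r a ι : Type*} {e f : ι → Type*} [Fintype ι]
    [DecidableEq ι] [Fintype r] [DecidableEq r] [∀ k, Fintype (e k)] [∀ k, Fintype (f k)]
    [Fintype a] [DecidableEq a] [∀ k, DecidableEq (e k)] [∀ k, DecidableEq (f k)]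
    {V : Matrix a (Σ k, e k × f k) ℂ} (hV : Vᴴ * V = 1)
    {X : ∀ k, Matrix (r × e k) (r × e k) ℂ} (hX : ∀ k, (X k).PosSemidef)
    {ω : ∀ k, Matrix (f k) (f k) ℂ} (hω : ∀ k, (ω k).IsHermitian) (hω1 : ∀ k, (ω k).trace = 1) :
    stateCoherentInformation (embed (refTensor r V) X ω) =
      ∑ k, (entropy (marginalB (X k)) - entropy (X k)) := by
  rw [stateCoherentInformation, marginalB_embed_refTensor,
    entropy_embed hV (fun k => (posSemidef_marginalB (hX k)).1) hω hω1,
    entropy_embed (refTensor_isometry hV) (fun k => (hX k).1) hω hω1, ← Finset.sum_sub_distrib]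
  refine Finset.sum_congr rfl fun k _ => ?_
  -- The terms `tr X_k · H(ω_k)` occur in both entropies with the same trace, and cancel.
  rw [trace_marginalB]
  ring

/-! ### Positivity of block operators -/

theorem embed_eq_sum {a ι : Type*} {e f : ι → Type*} [Fintype ι] [DecidableEq ι]
    [∀ k, Fintype (e k)] [∀ k, Fintype (f k)] (V : Matrix a (Σ k, e k × f k) ℂ)
    (X : ∀ k, Matrix (e k) (e k) ℂ) (ω : ∀ k, Matrix (f k) (f k) ℂ) :
    embed V X ω =
      ∑ k, V.submatrix id (Sigma.mk k) * (X k ⊗ₖ ω k) * (V.submatrix id (Sigma.mk k))ᴴ := by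
  ext i j
  simp only [embed, Matrix.mul_apply, Matrix.sum_apply, Fintype.sum_sigma]
  refine Finset.sum_congr rfl fun k _ => Finset.sum_congr rfl fun x _ => ?_
  congr 1
  rw [Finset.sum_eq_single k]
  · simp [Matrix.blockDiagonal'_apply_eq]
  · intro l _ hl
    simp [Matrix.blockDiagonal'_apply_ne _ _ _ hl]
  · simp

theorem posSemidef_embed {a ι : Type*} {e f : ι → Type*} [Fintype a] [Fintype ι] [DecidableEq ι]
    [∀ k, Fintype (e k)] [∀ k, Fintype (f k)] (V : Matrix a (Σ k, e k × f k) ℂ)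
    {X : ∀ k, Matrix (e k) (e k) ℂ} (hX : ∀ k, (X k).PosSemidef)
    {ω : ∀ k, Matrix (f k) (f k) ℂ} (hω : ∀ k, (ω k).PosSemidef) : (embed V X ω).PosSemidef := by
  rw [embed_eq_sum]
  exact Matrix.posSemidef_sum _ fun k _ => ((hX k).kronecker (hω k)).mul_mul_conjTranspose_same _

theorem embed_single {a ι : Type*} {e f : ι → Type*} [Fintype ι] [DecidableEq ι]
    [∀ k, Fintype (e k)] [∀ k, Fintype (f k)] (V : Matrix a (Σ k, e k × f k) ℂ) (k : ι)
    (F : Matrix (e k) (e k) ℂ) (ω : ∀ k, Matrix (f k) (f k) ℂ) :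
    embed V (Pi.single k F) ω =
      V.submatrix id (Sigma.mk k) * (F ⊗ₖ ω k) * (V.submatrix id (Sigma.mk k))ᴴ := by
  rw [embed_eq_sum, Finset.sum_eq_single k]
  · simp
  · intro l _ hl
    simp [Pi.single_eq_of_ne hl]
  · simp

theorem submatrix_sigma_isometry {a ι : Type*} {g : ι → Type*} [Fintype a]
    [DecidableEq ι] [∀ k, DecidableEq (g k)] {V : Matrix a (Σ k, g k) ℂ}
    (hV : Vᴴ * V = 1) (k : ι) :
    (V.submatrix id (Sigma.mk k))ᴴ * V.submatrix id (Sigma.mk k) = 1 := by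
  have h : (V.submatrix id (Sigma.mk k))ᴴ * V.submatrix id (Sigma.mk k) =
      (Vᴴ * V).submatrix (Sigma.mk k) (Sigma.mk k) := by
    ext i j
    simp [Matrix.mul_apply]
  rw [h, hV]
  ext i j
  simp [Matrix.one_apply]

theorem card_le_of_isometry {a b : Type*} [Fintype a] [Fintype b] [DecidableEq b]
    {A : Matrix a b ℂ} (hA : Aᴴ * A = 1) : Fintype.card b ≤ Fintype.card a := by
  have h := (Matrix.rank_mul_le_right Aᴴ A).trans (Matrix.rank_le_card_height A)
  rwa [hA, Matrix.rank_one] at h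

/-! ### Rank-one operators -/

theorem eq_zero_of_posSemidef_neg {a : Type*} [Fintype a] {M : Matrix a a ℂ}
    (h : M.PosSemidef) (h' : (-M).PosSemidef) : M = 0 := by
  refine h.trace_eq_zero_iff.1 (le_antisymm ?_ h.trace_nonneg)
  simpa [Matrix.trace_neg] using h'.trace_nonneg

/-- A positive operator dominated by a multiple of a rank-one projection is a multiple of it. -/
theorem eq_trace_smul_of_le_rankOne {a : Type*} [Fintype a] [DecidableEq a] {X : Matrix a a ℂ}
    {φ : a → ℂ} (hφ : star φ ⬝ᵥ φ = 1) {c : ℂ} (hX : X.PosSemidef)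
    (h : (c • Matrix.vecMulVec φ (star φ) - X).PosSemidef) :
    X = X.trace • Matrix.vecMulVec φ (star φ) := by
  set F := Matrix.vecMulVec φ (star φ) with hF
  have hFF : F * F = F := by rw [hF, Matrix.vecMulVec_mul_vecMulVec, hφ, one_smul]
  have hFh : Fᴴ = F := (Matrix.posSemidef_vecMulVec_self_star φ).1
  have hFQ : F * (1 - F) = 0 := by rw [mul_sub, hFF, mul_one, sub_self]
  have h1 := hX.conjTranspose_mul_mul_same (1 - F)
  have h2 := h.conjTranspose_mul_mul_same (1 - F)
  have h3 : (1 - F)ᴴ * (c • F - X) * (1 - F) = -((1 - F)ᴴ * X * (1 - F)) := by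
    rw [mul_assoc, mul_assoc, sub_mul, Matrix.smul_mul, hFQ, smul_zero, zero_sub, mul_neg]
  rw [h3] at h2
  -- Compression by `1 - F` kills the dominating `c • F`, so the compression of `X` is both
  -- nonnegative and nonpositive.
  have h4 := eq_zero_of_posSemidef_neg h1 h2
  have h5 : X * (1 - F) = 0 := by
    refine Matrix.ext_of_mulVec_single fun j => ?_
    rw [← Matrix.mulVec_mulVec, Matrix.zero_mulVec, ← hX.dotProduct_mulVec_zero_iff,
      Matrix.star_mulVec, ← Matrix.dotProduct_mulVec, Matrix.mulVec_mulVec, Matrix.mulVec_mulVec,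
      h4, Matrix.zero_mulVec, dotProduct_zero]
  have h6 : X = X * F := by rwa [mul_sub, mul_one, sub_eq_zero] at h5
  have h7 : X = F * X := by
    have := congrArg Matrix.conjTranspose h6
    rwa [Matrix.conjTranspose_mul, hFh, hX.1] at this
  have h8 : X = (star φ ⬝ᵥ X *ᵥ φ) • F := by
    conv_lhs => rw [h7, h6]
    rw [hF, Matrix.mul_vecMulVec, Matrix.vecMulVec_mul_vecMulVec, Matrix.vecMulVec_smul]
  have h9 : X.trace = star φ ⬝ᵥ X *ᵥ φ := by
    conv_lhs => rw [h8]
    rw [Matrix.trace_smul, hF, Matrix.trace_vecMulVec, dotProduct_comm φ, hφ, smul_eq_mul, mul_one]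
  rw [h9]
  exact h8

theorem entropy_rankOne {a : Type*} [Fintype a] [DecidableEq a] {φ : a → ℂ}
    (hφ : star φ ⬝ᵥ φ = 1) : entropy (Matrix.vecMulVec φ (star φ)) = 0 := by
  let A : Matrix a Unit ℂ := Matrix.of fun i _ => φ i
  have h1 : Matrix.vecMulVec φ (star φ) =
      A * Matrix.diagonal (fun _ : Unit => ((1 : ℝ) : ℂ)) * Aᴴ := by
    ext i j
    simp [A, Matrix.mul_apply, Matrix.vecMulVec_apply]
  have h2 : Aᴴ * A = 1 := by
    ext i j
    simpa [A, Matrix.mul_apply, dotProduct] using hφ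
  rw [h1, entropy_isometry_conj h2 (isHermitian_diagonal_ofReal _), entropy_diagonal]
  simp

/-! ### Mutual information of classical-quantum states -/

theorem marginalA_cqState {N : ℕ} {n : Type*} [Fintype n] (p : Fin N → ℝ)
    {ρ : Fin N → Matrix n n ℂ} (hρ : ∀ x, (ρ x).trace = 1) :
    marginalA (cqState p ρ) = Matrix.diagonal fun x => (p x : ℂ) := by
  ext x y
  have h (z : Fin N) : ∑ j, ρ z j j = 1 := hρ z
  simp only [marginalA, cqState, Matrix.of_apply, Matrix.sum_apply, Matrix.smul_apply,
    Matrix.kroneckerMap_apply, smul_eq_mul]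
  rw [Finset.sum_comm]
  simp only [← Finset.mul_sum, h, mul_one, Matrix.single_apply, Matrix.diagonal_apply]
  rw [Finset.sum_eq_single x]
  · simp
  · intro z _ hz
    simp [hz]
  · simp

theorem marginalB_cqState {N : ℕ} {n : Type*} (p : Fin N → ℝ) (ρ : Fin N → Matrix n n ℂ) :
    marginalB (cqState p ρ) = ∑ x, (p x : ℂ) • ρ x := by
  ext i j
  simp only [marginalB, cqState, Matrix.of_apply, Matrix.sum_apply, Matrix.smul_apply,
    Matrix.kroneckerMap_apply, smul_eq_mul]
  rw [Finset.sum_comm]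
  refine Finset.sum_congr rfl fun x _ => ?_
  rw [Finset.sum_eq_single x]
  · simp
  · intro z _ hz
    simp [Ne.symm hz]
  · simp

/-- A classical-quantum state is itself a block operator, with one-dimensional left factors `p x`
and right factors `ρ x`, so `entropy_embed` applies. -/
theorem entropy_cqState {N : ℕ} {n : Type*} [Fintype n] [DecidableEq n] (p : Fin N → ℝ)
    {ρ : Fin N → Matrix n n ℂ} (hρ : ∀ x, IsState (ρ x)) :
    entropy (cqState p ρ) = ∑ x, (Real.negMulLog (p x) + p x * entropy (ρ x)) := by
  let V : Matrix (Fin N × n) (Σ _ : Fin N, Unit × n) ℂ :=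
    Matrix.of fun s t => if s = (t.1, t.2.2) then 1 else 0
  have hV : Vᴴ * V = 1 := by
    ext ⟨x, u, i⟩ ⟨y, v, j⟩
    simp [V, Matrix.mul_apply, Matrix.one_apply]
    aesop
  have h : cqState p ρ = embed V (fun x => Matrix.diagonal fun _ : Unit => (p x : ℂ)) ρ := by
    rw [embed_eq_sum, cqState]
    refine Finset.sum_congr rfl fun x _ => ?_
    ext ⟨y, i⟩ ⟨z, j⟩
    simp [V, Matrix.mul_apply, Fintype.sum_prod_type, Matrix.single_apply, ite_and]
    aesop
  rw [h, entropy_embed hV (fun x => isHermitian_diagonal_ofReal _) (fun x => (hρ x).1.1)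
    fun x => (hρ x).2]
  simp [entropy_diagonal]

/-- The mutual information of a classical-quantum state is its Holevo information. -/
theorem mutualInformation_cqState {N : ℕ} {n : Type*} [Fintype n] [DecidableEq n] (p : Fin N → ℝ)
    {ρ : Fin N → Matrix n n ℂ} (hρ : ∀ x, IsState (ρ x)) :
    mutualInformation (cqState p ρ) =
      entropy (∑ x, (p x : ℂ) • ρ x) - ∑ x, p x * entropy (ρ x) := by
  rw [mutualInformation, marginalA_cqState p fun x => (hρ x).2, marginalB_cqState,
    entropy_cqState p hρ, entropy_diagonal, Finset.sum_add_distrib]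
  ring

/-- The `ω k` contributions are linear in the blocks, hence equal for the averaged state and the
average over the ensemble. -/
theorem mutualInformation_cqState_embed {N : ℕ} {a ι : Type*} {e f : ι → Type*} [Fintype ι]
    [DecidableEq ι] [∀ k, Fintype (e k)] [∀ k, Fintype (f k)]
    [Fintype a] [DecidableEq a] [∀ k, DecidableEq (e k)] [∀ k, DecidableEq (f k)]
    {V : Matrix a (Σ k, e k × f k) ℂ} (hV : Vᴴ * V = 1) (p : Fin N → ℝ)
    {X : Fin N → ∀ k, Matrix (e k) (e k) ℂ} (hX : ∀ x k, (X x k).IsHermitian)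
    {ω : ∀ k, Matrix (f k) (f k) ℂ} (hω : ∀ k, (ω k).IsHermitian) (hω1 : ∀ k, (ω k).trace = 1)
    (hs : ∀ x, IsState (embed V (X x) ω)) :
    mutualInformation (cqState p fun x => embed V (X x) ω) =
      ∑ k, entropy (∑ x, (p x : ℂ) • X x k) - ∑ x, p x * ∑ k, entropy (X x k) := by
  have hH (k : ι) : (∑ x, (p x : ℂ) • X x k).IsHermitian := by
    rw [Matrix.IsHermitian, Matrix.conjTranspose_sum]
    refine Finset.sum_congr rfl fun x _ => ?_
    rw [Matrix.conjTranspose_smul, hX x k]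
    simp
  rw [mutualInformation_cqState p hs]
  simp only [embed_smul]
  rw [embed_sum Finset.univ V (fun x k => (p x : ℂ) • X x k), entropy_embed hV hH hω hω1]
  simp only [entropy_embed hV (hX _) hω hω1, Finset.sum_add_distrib, mul_add, Finset.mul_sum]
  have : ∑ k, (∑ x, (p x : ℂ) • X x k).trace.re * entropy (ω k) =
      ∑ x, ∑ k, p x * ((X x k).trace.re * entropy (ω k)) := by
    rw [Finset.sum_comm]
    refine Finset.sum_congr rfl fun k _ => ?_
    simp [Matrix.trace_sum, Matrix.trace_smul, Finset.sum_mul, mul_assoc]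
  rw [this]
  ring

/-- Jensen is applied once to the combined list of eigenvalues of all blocks, giving the logarithm
of a sum of dimensions. -/
theorem sum_entropy_le {ι : Type*} {e : ι → Type*} [Fintype ι] [∀ k, Fintype (e k)]
    [∀ k, DecidableEq (e k)] {X : ∀ k, Matrix (e k) (e k) ℂ} (hX : ∀ k, (X k).PosSemidef)
    (h1 : ∑ k, (X k).trace.re = 1) :
    ∑ k, entropy (X k) ≤ Real.log (∑ k, (Fintype.card (e k) : ℝ)) := by
  have h := sum_negMulLog_le (fun t : Σ k, e k => (hX t.1).1.eigenvalues t.2)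
    fun t => (hX t.1).eigenvalues_nonneg t.2
  have h2 (k : ι) : ∑ i, (hX k).1.eigenvalues i = (X k).trace.re := sum_eigenvalues_eq_trace_re _
  have h3 (k : ι) : ∑ i, Real.negMulLog ((hX k).1.eigenvalues i) = entropy (X k) :=
    (entropy_eq_sum_eigenvalues _).symm
  simp only [Fintype.sum_sigma, h2, h3, h1, Fintype.card_sigma] at h
  simpa using h

/-! ### Channels whose range is a space of block operators -/

section blockRange

set_option linter.unusedSectionVars false

variable {n ι : Type*} {e f : ι → Type*} [Fintype n] [DecidableEq n] [Fintype ι] [DecidableEq ι]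
  [∀ k, Fintype (e k)] [∀ k, Fintype (f k)] [∀ k, DecidableEq (e k)] [∀ k, DecidableEq (f k)]
  {P : Matrix n n ℂ →ₗ[ℂ] Matrix n n ℂ} {V : Matrix n (Σ k, e k × f k) ℂ}
  {ω : ∀ k, Matrix (f k) (f k) ℂ}

theorem isState_embed (hV : Vᴴ * V = 1) (hω : ∀ k, IsState (ω k))
    {X : ∀ k, Matrix (e k) (e k) ℂ} (hX : ∀ k, (X k).PosSemidef) (h1 : ∑ k, (X k).trace = 1) :
    IsState (embed V X ω) :=
  ⟨posSemidef_embed V hX fun k => (hω k).1, by rw [trace_embed hV X fun k => (hω k).2, h1]⟩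

theorem exists_idTensor_eq_embed {r : Type*} [Fintype r] [DecidableEq r]
    (hr : ∀ ρ, ∃ X, P ρ = embed V X ω) (M : Matrix (r × n) (r × n) ℂ) :
    ∃ X, idTensor r P M = embed (refTensor r V) X ω := by
  choose X hX using fun s t : r => hr (Matrix.of fun i j => M (s, i) (t, j))
  refine ⟨fun k => Matrix.of fun u v => X u.1 v.1 k u.2 v.2, ?_⟩
  ext ⟨s, i⟩ ⟨t, j⟩
  rw [embed_refTensor_apply]
  exact congrFun (congrFun (hX s t) i) j

theorem idTensor_embed_refTensor {r : Type*} [Fintype r] [DecidableEq r]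
    (hfix : ∀ X, P (embed V X ω) = embed V X ω) (X : ∀ k, Matrix (r × e k) (r × e k) ℂ) :
    idTensor r P (embed (refTensor r V) X ω) = embed (refTensor r V) X ω := by
  ext ⟨s, i⟩ ⟨t, j⟩
  have h : (Matrix.of fun i j => embed (refTensor r V) X ω (s, i) (t, j)) =
      embed V (fun k => Matrix.of fun x y => X k (s, x) (t, y)) ω := by
    ext i j
    rw [Matrix.of_apply, embed_refTensor_apply]
  simp only [idTensor, Matrix.of_apply]
  rw [h, hfix, embed_refTensor_apply]

theorem sum_trace_re_eq_one (hV : Vᴴ * V = 1) (hω : ∀ k, IsState (ω k))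
    {X : ∀ k, Matrix (e k) (e k) ℂ} (h1 : (embed V X ω).trace = 1) :
    ∑ k, (X k).trace.re = 1 := by
  rw [trace_embed hV X fun k => (hω k).2] at h1
  rw [← Complex.re_sum, h1, Complex.one_re]

/-! ### The Holevo quantity: upper bound and attaining ensemble. -/

theorem holevoQuantity_le (hP : IsQuantumChannel P) (hV : Vᴴ * V = 1) (hω : ∀ k, IsState (ω k))
    (hr : ∀ ρ, ∃ X, P ρ = embed V X ω) :
    holevoQuantity P ≤ ((Real.log (∑ k, (Fintype.card (e k) : ℝ)) : ℝ) : EReal) := by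
  refine iSup_le fun N => iSup_le fun E => EReal.coe_le_coe_iff.2 ?_
  choose X hX using fun x => hr (E.ρ x)
  have hs (x) : IsState (embed V (X x) ω) := by
    rw [← hX]
    exact ⟨hP.posSemidef_apply (E.ρ_isState x).1,
      (hP.tracePreserving _).trans (E.ρ_isState x).2⟩
  have hpos (x k) : (X x k).PosSemidef :=
    posSemidef_of_embed hV (fun k => (hω k).2) (hs x).1 k
  have ht (x) : ∑ k, (X x k).trace.re = 1 := sum_trace_re_eq_one hV hω (hs x).2
  -- Each block has trace at most one, where `negMulLog` is nonnegative.
  have hent (x k) : 0 ≤ entropy (X x k) := by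
    refine (Real.negMulLog_nonneg (trace_re_nonneg (hpos x k)) ?_).trans
      (negMulLog_trace_le_entropy (hpos x k))
    rw [← ht x]
    exact Finset.single_le_sum (fun l _ => trace_re_nonneg (hpos x l)) (Finset.mem_univ k)
  have hp (x) : (0 : ℂ) ≤ (E.p x : ℂ) := by exact_mod_cast E.p_nonneg x
  rw [idTensor_cqState]
  simp only [hX]
  rw [mutualInformation_cqState_embed hV E.p (fun x k => (hpos x k).1) (fun k => (hω k).1.1)
    (fun k => (hω k).2) hs]
  refine (sub_le_self _ (Finset.sum_nonneg fun x _ =>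
    mul_nonneg (E.p_nonneg x) (Finset.sum_nonneg fun k _ => hent x k))).trans ?_
  refine sum_entropy_le (fun k => Matrix.posSemidef_sum _ fun x _ => (hpos x k).smul (hp x)) ?_
  have : ∀ k, (∑ x, (E.p x : ℂ) • X x k).trace.re = ∑ x, E.p x * (X x k).trace.re := by
    intro k
    simp [Matrix.trace_sum, Matrix.trace_smul]
  simp only [this]
  rw [Finset.sum_comm]
  simp only [← Finset.mul_sum, ht, mul_one, E.p_sum]

theorem le_holevoQuantity (hV : Vᴴ * V = 1) (hω : ∀ k, IsState (ω k))
    (hfix : ∀ X, P (embed V X ω) = embed V X ω) [Nonempty (Σ k, e k)] :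
    ((Real.log (∑ k, (Fintype.card (e k) : ℝ)) : ℝ) : EReal) ≤ holevoQuantity P := by
  let N := Fintype.card (Σ k, e k)
  let E : Fin N ≃ Σ k, e k := (Fintype.equivFin _).symm
  -- Letter `x` is a basis projection in a single block: its entropy is zero, and the uniform
  -- average is `N⁻¹` times the identity in every block.
  let X : Fin N → ∀ k, Matrix (e k) (e k) ℂ := fun x k =>
    Matrix.diagonal fun i => ((if (⟨k, i⟩ : Σ k, e k) = E x then 1 else 0 : ℝ) : ℂ)
  have hN : (0 : ℝ) < N := by exact_mod_cast Fintype.card_pos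
  have hX (x k) : (X x k).PosSemidef := Matrix.PosSemidef.diagonal fun i => by
    split_ifs <;> simp
  have hs (x) : IsState (embed V (X x) ω) := by
    refine isState_embed hV hω (hX x) ?_
    have : ∑ k, (X x k).trace = ∑ t : Σ k, e k, if t = E x then (1 : ℂ) else 0 := by
      rw [Fintype.sum_sigma]
      refine Finset.sum_congr rfl fun k _ => ?_
      simp only [X, Matrix.trace_diagonal, apply_ite Complex.ofReal, Complex.ofReal_one,
        Complex.ofReal_zero]
    rw [this]
    simp
  have hent (x k) : entropy (X x k) = 0 := by
    rw [entropy_diagonal]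
    refine Finset.sum_eq_zero fun i _ => ?_
    split_ifs <;> simp
  have havg (k) : ∑ x, (((N : ℝ)⁻¹ : ℝ) : ℂ) • X x k =
      Matrix.diagonal fun _ => (((N : ℝ)⁻¹ : ℝ) : ℂ) := by
    ext i j
    simp only [X, Matrix.sum_apply, Matrix.smul_apply, Matrix.diagonal_apply]
    split_ifs with hij
    · rw [E.sum_comp fun t => (((N : ℝ)⁻¹ : ℝ) : ℂ) •
        ((if (⟨k, i⟩ : Σ k, e k) = t then 1 else 0 : ℝ) : ℂ), ← Finset.smul_sum]
      simp only [apply_ite Complex.ofReal, Complex.ofReal_one, Complex.ofReal_zero,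
        Finset.sum_ite_eq, Finset.mem_univ, if_true, smul_eq_mul, mul_one]
    · simp
  let S : Ensemble N n :=
    { p := fun _ => (N : ℝ)⁻¹
      p_nonneg := fun _ => by positivity
      p_sum := by simp [hN.ne']
      ρ := fun x => embed V (X x) ω
      ρ_isState := hs }
  refine le_iSup_of_le N (le_iSup_of_le S (EReal.coe_le_coe_iff.2 (le_of_eq ?_)))
  rw [idTensor_cqState]
  simp only [S, hfix]
  rw [mutualInformation_cqState_embed hV _ (fun x k => (hX x k).1) (fun k => (hω k).1.1)
    (fun k => (hω k).2) hs]
  simp only [hent, havg, entropy_diagonal]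
  have hcard : ∑ k, (Fintype.card (e k) : ℝ) = N := by simp [N]
  simp only [Finset.sum_const, Finset.card_univ, nsmul_eq_mul, ← Finset.sum_mul, hcard,
    Real.negMulLog, Real.log_inv]
  field_simp
  simp

/-! ### The coherent information: upper bound and attaining pure input. -/

theorem sum_entropy_marginalB_sub_le {r : Type*} [Fintype r] [DecidableEq r]
    {X : ∀ k, Matrix (r × e k) (r × e k) ℂ} (hX : ∀ k, (X k).PosSemidef)
    (h1 : ∑ k, (X k).trace.re = 1) {D : ℕ} (hD : ∀ k, Fintype.card (e k) ≤ D) :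
    ∑ k, (entropy (marginalB (X k)) - entropy (X k)) ≤ Real.log D := by
  calc ∑ k, (entropy (marginalB (X k)) - entropy (X k))
      ≤ ∑ k, (X k).trace.re * Real.log D := by
        refine Finset.sum_le_sum fun k _ => ?_
        have hu := entropy_le (posSemidef_marginalB (hX k))
        have hl := negMulLog_trace_le_entropy (hX k)
        rw [trace_marginalB] at hu
        have hlog : Real.log (Fintype.card (e k)) ≤ Real.log D := by
          rcases Nat.eq_zero_or_pos (Fintype.card (e k)) with h | h
          · rw [h, Nat.cast_zero, Real.log_zero]
            exact Real.log_natCast_nonneg D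
          · exact Real.log_le_log (by exact_mod_cast h) (by exact_mod_cast hD k)
        have := mul_le_mul_of_nonneg_left hlog (trace_re_nonneg (hX k))
        linarith
    _ = Real.log D := by rw [← Finset.sum_mul, h1, one_mul]

/-- Only positivity and unit trace of the output blocks enter; purity of the input plays no further
role. -/
theorem coherentInformation_le (hP : IsQuantumChannel P) (hV : Vᴴ * V = 1)
    (hω : ∀ k, IsState (ω k)) (hr : ∀ ρ, ∃ X, P ρ = embed V X ω) {D : ℕ}
    (hD : ∀ k, Fintype.card (e k) ≤ D) :
    coherentInformation P ≤ ((Real.log D : ℝ) : EReal) := by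
  refine iSup_le fun ρ => iSup_le fun hρ => EReal.coe_le_coe_iff.2 ?_
  obtain ⟨ψ, hψ, rfl⟩ := hρ
  obtain ⟨X, hX⟩ := exists_idTensor_eq_embed (r := n) hr (Matrix.vecMulVec ψ (star ψ))
  have hσ := hP.posSemidef_idTensor (Matrix.posSemidef_vecMulVec_self_star ψ)
  have htr := hP.trace_idTensor (Matrix.vecMulVec ψ (star ψ))
  rw [Matrix.trace_vecMulVec, dotProduct_comm, hψ, hX] at htr
  rw [hX] at hσ
  have hpos := posSemidef_of_embed (refTensor_isometry hV) (fun k => (hω k).2) hσ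
  rw [hX, stateCoherentInformation_embed hV hpos (fun k => (hω k).1.1) fun k => (hω k).2]
  exact sum_entropy_marginalB_sub_le hpos (sum_trace_re_eq_one (refTensor_isometry hV) hω htr) hD

/-- A state dominates a nonzero rank-one operator. -/
theorem IsState.exists_rankOne_le {a : Type*} [Fintype a] {ω : Matrix a a ℂ} (hω : IsState ω) :
    ∃ b : a → ℂ, b ≠ 0 ∧ (ω - Matrix.vecMulVec b (star b)).PosSemidef := by
  obtain ⟨m, v, hv⟩ := Matrix.posSemidef_iff_eq_sum_vecMulVec.1 hω.1
  have hy : ∃ y, v y ≠ 0 := by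
    by_contra! h
    have h1 := hω.2
    rw [hv] at h1
    simp [h] at h1
  obtain ⟨y, hy⟩ := hy
  refine ⟨v y, hy, ?_⟩
  rw [hv, ← Finset.add_sum_erase _ _ (Finset.mem_univ y), add_sub_cancel_left]
  exact Matrix.posSemidef_sum _ fun z _ => Matrix.posSemidef_vecMulVec_self_star _

theorem vecMulVec_kronecker {a b : Type*} (φ : a → ℂ) (β : b → ℂ) :
    Matrix.vecMulVec φ (star φ) ⊗ₖ Matrix.vecMulVec β (star β) =
      Matrix.vecMulVec (fun s => φ s.1 * β s.2) (star fun s : a × b => φ s.1 * β s.2) := by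
  ext ⟨i, j⟩ ⟨i', j'⟩
  simp [Matrix.vecMulVec_apply]
  ring

theorem conj_vecMulVec {a b : Type*} [Fintype b] (W : Matrix a b ℂ) (φ : b → ℂ) :
    W * Matrix.vecMulVec φ (star φ) * Wᴴ = Matrix.vecMulVec (W *ᵥ φ) (star (W *ᵥ φ)) := by
  rw [Matrix.mul_vecMulVec, Matrix.vecMulVec_mul, Matrix.star_mulVec]

/-- A suitable pure input state is sent by a projection onto block operators to the state which is
a given pure state tensored with `ω k` on the `k`-th block. -/
theorem exists_pure_idTensor_eq {r : Type*} [Fintype r] [DecidableEq r]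
    (hP : IsQuantumChannel P) (hV : Vᴴ * V = 1) (hω : ∀ k, IsState (ω k))
    (hr : ∀ ρ, ∃ X, P ρ = embed V X ω) (hfix : ∀ X, P (embed V X ω) = embed V X ω)
    (k : ι) {φ : r × e k → ℂ} (hφ : star φ ⬝ᵥ φ = 1) :
    ∃ ρ : Matrix (r × n) (r × n) ℂ, IsPureState ρ ∧ idTensor r P ρ =
      embed (refTensor r V) (Pi.single k (Matrix.vecMulVec φ (star φ))) ω := by
  -- Replacing `ω k` by the rank-one operator of `b` below it yields a pure vector `W (φ ⊗ b)` whose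
  -- projector `ρ₀` lies below the fixed operator `T`.
  obtain ⟨b, hb0, hb⟩ := (hω k).exists_rankOne_le
  set F := Matrix.vecMulVec φ (star φ) with hF
  have hFpos : F.PosSemidef := Matrix.posSemidef_vecMulVec_self_star φ
  set V' := refTensor r V with hV'
  have hV1 : V'ᴴ * V' = 1 := refTensor_isometry hV
  set W := V'.submatrix id (Sigma.mk k) with hW
  have hW1 : Wᴴ * W = 1 := submatrix_sigma_isometry hV1 k
  let χ : (r × e k) × f k → ℂ := fun s => φ s.1 * b s.2
  obtain ⟨q, hq0, hq⟩ : ∃ q : ℝ, 0 < q ∧ star b ⬝ᵥ b = (q : ℂ) :=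
    have h := Complex.pos_iff.1 (Matrix.dotProduct_star_self_pos_iff.2 hb0)
    ⟨_, h.1, Complex.ext rfl h.2.symm⟩
  have hχ : star χ ⬝ᵥ χ = (q : ℂ) := by
    have h : star χ ⬝ᵥ χ = (star φ ⬝ᵥ φ) * (star b ⬝ᵥ b) := by
      rw [dotProduct, dotProduct, dotProduct, Finset.sum_mul_sum, ← Fintype.sum_prod_type']
      refine Finset.sum_congr rfl fun s _ => ?_
      simp only [Pi.star_apply, χ, star_mul]
      ring
    rw [h, hφ, hq, one_mul]
  have hWχ : star (W *ᵥ χ) ⬝ᵥ (W *ᵥ χ) = (q : ℂ) := by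
    rw [Matrix.star_mulVec, ← Matrix.dotProduct_mulVec, Matrix.mulVec_mulVec, hW1,
      Matrix.one_mulVec, hχ]
  set T := embed V' (Pi.single k F) ω with hT
  set ρ₀ := Matrix.vecMulVec (W *ᵥ χ) (star (W *ᵥ χ)) with hρ₀
  have hsub : (T - ρ₀).PosSemidef := by
    have h : T - ρ₀ = W * (F ⊗ₖ (ω k - Matrix.vecMulVec b (star b))) * Wᴴ := by
      rw [hT, embed_single, hρ₀, ← conj_vecMulVec, ← vecMulVec_kronecker, ← Matrix.sub_mul,
        ← Matrix.mul_sub]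
      congr 2
      ext s t
      simp [F, mul_sub]
    rw [h]
    exact (hFpos.kronecker hb).mul_mul_conjTranspose_same W
  have hqc : (0 : ℂ) ≤ ((q⁻¹ : ℝ) : ℂ) := by
    exact_mod_cast (inv_pos.2 hq0).le
  have hpure : IsPureState (((q⁻¹ : ℝ) : ℂ) • ρ₀) := by
    have hs : (((Real.sqrt q)⁻¹ : ℝ) : ℂ) * (((Real.sqrt q)⁻¹ : ℝ) : ℂ) = ((q⁻¹ : ℝ) : ℂ) := by
      rw [← Complex.ofReal_mul, ← mul_inv, Real.mul_self_sqrt hq0.le]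
    refine ⟨(((Real.sqrt q)⁻¹ : ℝ) : ℂ) • (W *ᵥ χ), ?_, ?_⟩
    · rw [star_smul, smul_dotProduct, dotProduct_smul, hWχ, smul_eq_mul, smul_eq_mul, ← mul_assoc,
        Complex.star_def, Complex.conj_ofReal, hs, ← Complex.ofReal_mul, inv_mul_cancel₀ hq0.ne',
        Complex.ofReal_one]
    · rw [star_smul, Matrix.smul_vecMulVec, Matrix.vecMulVec_smul, smul_smul, Complex.star_def,
        Complex.conj_ofReal, hs]
  refine ⟨_, hpure, ?_⟩
  have hρpos : (((q⁻¹ : ℝ) : ℂ) • ρ₀).PosSemidef :=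
    (Matrix.posSemidef_vecMulVec_self_star _).smul hqc
  obtain ⟨X, hX⟩ := exists_idTensor_eq_embed (r := r) hr (((q⁻¹ : ℝ) : ℂ) • ρ₀)
  rw [← hV'] at hX
  have hω1 := fun k => (hω k).2
  have hXpos := posSemidef_of_embed hV1 hω1 (hX ▸ hP.posSemidef_idTensor hρpos)
  -- Since `T` is fixed, positivity bounds the output blocks by those of `q⁻¹ • T`: all others
  -- vanish, and block `k` is a multiple of `F`, which the trace then determines.
  have hdiff := hP.posSemidef_idTensor (hsub.smul hqc)
  rw [smul_sub, idTensor_sub, hX, idTensor_smul, hT, hV', idTensor_embed_refTensor hfix,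
    embed_smul, embed_sub, ← hV'] at hdiff
  have hdiff := posSemidef_of_embed hV1 hω1 hdiff
  have hne : ∀ l, l ≠ k → X l = 0 := by
    intro l hl
    have h := hdiff l
    rw [Pi.single_eq_of_ne hl, smul_zero, zero_sub] at h
    exact eq_zero_of_posSemidef_neg (hXpos l) h
  have hk : X k = (X k).trace • F := by
    have h := hdiff k
    rw [Pi.single_eq_same] at h
    exact eq_trace_smul_of_le_rankOne hφ (hXpos k) h
  have htr : (X k).trace = 1 := by
    have h := hP.trace_idTensor (((q⁻¹ : ℝ) : ℂ) • ρ₀)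
    rw [hX, trace_embed hV1 X hω1, Finset.sum_eq_single k
      (fun l _ hl => by rw [hne l hl, Matrix.trace_zero]) (by simp), Matrix.trace_smul, hρ₀,
      Matrix.trace_vecMulVec, dotProduct_comm, hWχ, smul_eq_mul, ← Complex.ofReal_mul,
      inv_mul_cancel₀ hq0.ne', Complex.ofReal_one] at h
    exact h
  rw [hX]
  congr 1
  funext l
  rcases eq_or_ne l k with rfl | hl
  · rw [Pi.single_eq_same, hk, htr, one_smul]
  · rw [Pi.single_eq_of_ne hl, hne l hl]

theorem le_coherentInformation (hP : IsQuantumChannel P) (hV : Vᴴ * V = 1)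
    (hω : ∀ k, IsState (ω k)) (hr : ∀ ρ, ∃ X, P ρ = embed V X ω)
    (hfix : ∀ X, P (embed V X ω) = embed V X ω) (k : ι) [Nonempty (e k)] :
    ((Real.log (Fintype.card (e k)) : ℝ) : EReal) ≤ coherentInformation P := by
  have hD : (0 : ℝ) < Fintype.card (e k) := by exact_mod_cast Fintype.card_pos
  set D : ℝ := (Fintype.card (e k) : ℝ) with hDdef
  -- The reference is indexed by `n`, so it must have room for a copy of the left factor; it does,
  -- as `V` embeds `e k × f k` isometrically and `f k` is nonempty.
  obtain ⟨g⟩ : Nonempty (e k ↪ n) := by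
    have hf : Nonempty (f k) := by
      by_contra h
      rw [not_nonempty_iff] at h
      simpa [Matrix.trace] using (hω k).2
    refine Function.Embedding.nonempty_of_card_le (le_trans ?_
      (card_le_of_isometry (submatrix_sigma_isometry hV k)))
    rw [Fintype.card_prod]
    exact Nat.le_mul_of_pos_right _ Fintype.card_pos
  -- The maximally entangled vector along `g`: its state is pure with maximally mixed marginal, so
  -- the coherent information is `log D - 0`.
  let φ : n × e k → ℂ := fun s => if s.1 = g s.2 then (((Real.sqrt D)⁻¹ : ℝ) : ℂ) else 0
  have hs : (((Real.sqrt D)⁻¹ : ℝ) : ℂ) * (((Real.sqrt D)⁻¹ : ℝ) : ℂ) = ((D⁻¹ : ℝ) : ℂ) := by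
    rw [← Complex.ofReal_mul, ← mul_inv, Real.mul_self_sqrt hD.le]
  have hmarg : marginalB (Matrix.vecMulVec φ (star φ)) =
      Matrix.diagonal fun _ : e k => ((D⁻¹ : ℝ) : ℂ) := by
    ext i j
    simp only [marginalB, Matrix.of_apply, Matrix.vecMulVec_apply, Pi.star_apply, φ, apply_ite star,
      star_zero, Complex.star_def, Complex.conj_ofReal, ite_mul, zero_mul, Finset.sum_ite_eq',
      Finset.mem_univ, if_true, Matrix.diagonal_apply, mul_ite, mul_zero, hs,
      g.injective.eq_iff]
    exact if_congr eq_comm rfl rfl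
  have hφ : star φ ⬝ᵥ φ = 1 := by
    rw [dotProduct_comm, ← Matrix.trace_vecMulVec, ← trace_marginalB, hmarg, Matrix.trace_diagonal,
      Finset.sum_const, Finset.card_univ, nsmul_eq_mul]
    simp [hDdef]
  obtain ⟨ρ, hρ, hout⟩ := exists_pure_idTensor_eq hP hV hω hr hfix k hφ
  refine le_iSup_of_le ρ (le_iSup_of_le hρ (EReal.coe_le_coe_iff.2 (le_of_eq ?_)))
  have hpos (l) : ((Pi.single k (Matrix.vecMulVec φ (star φ)) :
      ∀ k, Matrix (n × e k) (n × e k) ℂ) l).PosSemidef := by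
    rcases eq_or_ne l k with rfl | hl
    · rw [Pi.single_eq_same]
      exact Matrix.posSemidef_vecMulVec_self_star φ
    · rw [Pi.single_eq_of_ne hl]
      exact Matrix.PosSemidef.zero
  rw [hout, stateCoherentInformation_embed hV hpos (fun k => (hω k).1.1) (fun k => (hω k).2),
    Finset.sum_eq_single k, Pi.single_eq_same, hmarg, entropy_rankOne hφ, entropy_diagonal,
    Finset.sum_const, Finset.card_univ, nsmul_eq_mul, Real.negMulLog, Real.log_inv, ← hDdef]
  · field_simp
    simp
  · intro l _ hl
    have h0 : marginalB (0 : Matrix (n × e l) (n × e l) ℂ) = 0 := by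
      ext i j
      simp [marginalB]
    rw [Pi.single_eq_of_ne hl, h0]
    simp [entropy]
  · simp

end blockRange


end QInfo

theorem mainTheorem5 {n : Type*} [Fintype n] [DecidableEq n] [Nonempty n]
    (Φ P : Matrix n n ℂ →ₗ[ℂ] Matrix n n ℂ)
    (hΦ : QInfo.IsQuantumChannel Φ) (hP : QInfo.IsPeripheralProjection Φ P)
    {K : ℕ} (d m : Fin K → ℕ)
    (V : Matrix n (Σ k, Fin (d k) × Fin (m k)) ℂ) (hV : Vᴴ * V = 1)
    (ω : ∀ k, Matrix (Fin (m k)) (Fin (m k)) ℂ)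
    (hω : ∀ k, (ω k).PosDef ∧ (ω k).trace = 1)
    (hX : (QInfo.peripheralSubspace Φ : Set (Matrix n n ℂ)) = QInfo.blockSubspace V ω) :
    QInfo.holevoQuantity P = ((Real.log (∑ k, (d k : ℝ)) : ℝ) : EReal) ∧
      QInfo.coherentInformation P =
        ((Real.log ((Finset.univ.sup d : ℕ) : ℝ) : ℝ) : EReal) := by
  have hQ := hP.isQuantumChannel hΦ
  have hs (k) : QInfo.IsState (ω k) := ⟨(hω k).1.posSemidef, (hω k).2⟩
  have hr (ρ) : ∃ X, P ρ = QInfo.embed V X ω := by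
    have h : P ρ ∈ (QInfo.peripheralSubspace Φ : Set (Matrix n n ℂ)) :=
      hP.range_eq ▸ LinearMap.mem_range_self P ρ
    rwa [hX] at h
  have hfix (X) : P (QInfo.embed V X ω) = QInfo.embed V X ω := by
    refine hP.fixes _ (SetLike.mem_coe.1 ?_)
    rw [hX]
    exact ⟨X, rfl⟩
  -- If every `d k` were zero, all outputs of `P` would have trace zero, contradicting trace
  -- preservation on a diagonal matrix unit.
  obtain ⟨k, hk⟩ : ∃ k, 0 < d k := by
    by_contra! h
    obtain ⟨i⟩ := ‹Nonempty n›
    obtain ⟨X, h1⟩ := hr (Matrix.single i i 1)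
    have h2 := hQ.tracePreserving (Matrix.single i i 1)
    rw [h1, QInfo.trace_embed hV X fun k => (hs k).2, Matrix.trace_single_eq_same] at h2
    refine zero_ne_one ((Finset.sum_eq_zero fun k _ => ?_).symm.trans h2)
    have : IsEmpty (Fin (d k)) := by
      rw [Nat.le_zero.1 (h k)]
      infer_instance
    simp [Matrix.trace]
  constructor
  · have : Nonempty (Σ k, Fin (d k)) := ⟨⟨k, 0, hk⟩⟩
    have hu := QInfo.holevoQuantity_le hQ hV hs hr
    have hl := QInfo.le_holevoQuantity (P := P) hV hs hfix
    simp only [Fintype.card_fin] at hu hl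
    exact le_antisymm hu hl
  · obtain ⟨l, -, hl⟩ := Finset.exists_mem_eq_sup Finset.univ ⟨k, Finset.mem_univ k⟩ d
    refine le_antisymm (QInfo.coherentInformation_le hQ hV hs hr fun k => ?_) ?_
    · rw [Fintype.card_fin]
      exact Finset.le_sup (Finset.mem_univ k)
    · have : Nonempty (Fin (d l)) :=
        ⟨⟨0, hk.trans_le (hl ▸ Finset.le_sup (Finset.mem_univ k))⟩⟩
      have h := QInfo.le_coherentInformation hQ hV hs hr hfix l
      rwa [Fintype.card_fin, ← hl] at h
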